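/- A map $f=(f_1,\dots,f_n):\mathbb{R}^m\to\mathbb{R}^n$ is called polynomial if each $f_i$ is a polynomial function with real coefficients, and $S\subseteq\mathbb{R}^n$ is a polynomial image of $\mathbb{R}^m$ if $S=f(\mathbb{R}^m)$ for some polynomial map $f:\mathbb{R}^m\to\mathbb{R}^n$. Let $n\ge 2$, let $\|\cdot\|$ be the Euclidean norm on $\mathbb{R}^n$, and put $$g(t)=\frac{1+2n}{2n^3(1+n)^2}\,t^4-\frac{1+2n+3n^2+4n^3}{2n^3(1+n)^2}\,t^2+\frac{3+6n+4n^2+2n^3}{2n(1+n)^2}.$$ (a) For every $c\in\mathbb{R}^n$ and $r>0$, the complement $\{x\in\mathbb{R}^n:\|x-c\|\ge r\}$ of the open ball with centre $c$ and radius $r$ is a polynomial image of $\mathbb{R}^n$. (b) More precisely, for the unit ball: the map $\rho:\mathbb{R}^n\to\mathbb{R}^n$, $\rho(x)=g(\|x\|)\,x$, is polynomial, and there is a polynomial map $f:\mathbb{R}^n\to\mathbb{R}^n$ with image $f(\mathbb{R}^n)=\mathbb{R}^n\setminus[-1,1]^n$ such that $\rho\circ f$ is a polynomial map with image $(\rho\circ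 f)(\mathbb{R}^n)=\{x\in\mathbb{R}^n:\|x\|\ge 1\}$. -/

import Mathlib

open Polynomial

/-- A map between Euclidean spaces is polynomial if each coordinate of its value is given by
evaluating a real polynomial in the coordinates of the argument. -/
def IsPolynomialMap {m n : ℕ} (f : EuclideanSpace ℝ (Fin m) → EuclideanSpace ℝ (Fin n)) : Prop :=
  ∃ p : Fin n → MvPolynomial (Fin m) ℝ,
    ∀ (x : EuclideanSpace ℝ (Fin m)) (i : Fin n), f x i = MvPolynomial.eval (fun j => x j) (p i)

/-- `S ⊆ ℝⁿ` is a polynomial image of `ℝᵐ`. -/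
def IsPolynomialImage (m : ℕ) {n : ℕ} (S : Set (EuclideanSpace ℝ (Fin n))) : Prop :=
  ∃ f : EuclideanSpace ℝ (Fin m) → EuclideanSpace ℝ (Fin n), IsPolynomialMap f ∧ Set.range f = S

/-- The closed cube `[-1,1]ⁿ`. -/
def closedCube (n : ℕ) : Set (EuclideanSpace ℝ (Fin n)) :=
  {x | ∀ i, x i ∈ Set.Icc (-1 : ℝ) 1}

/-- The even quartic `g = a t⁴ + b t² + c` with its explicit coefficients depending on `n`. -/
noncomputable def radialQuartic (n : ℕ) : ℝ[X] :=
  C ((1 + 2 * (n : ℝ)) / (2 * (n : ℝ) ^ 3 * (1 + n) ^ 2)) * X ^ 4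
    + C (-((1 + 2 * (n : ℝ) + 3 * (n : ℝ) ^ 2 + 4 * (n : ℝ) ^ 3)
        / (2 * (n : ℝ) ^ 3 * (1 + n) ^ 2))) * X ^ 2
    + C ((3 + 6 * (n : ℝ) + 4 * (n : ℝ) ^ 2 + 2 * (n : ℝ) ^ 3) / (2 * (n : ℝ) * (1 + n) ^ 2))

/-- The radial map `x ↦ g(‖x‖) x`. -/
noncomputable def radialMap (n : ℕ) (x : EuclideanSpace ℝ (Fin n)) : EuclideanSpace ℝ (Fin n) :=
  (radialQuartic n).eval ‖x‖ • x

/-! The complement of the cube is built by shears that change one coordinate at a time. Replacing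
`x_a` by `x_a (1 + e (x_a² - B))` with `e = 1 - x_k²` does two things. Where `|x_k| > 1` the leading
coefficient is negative, and already `x_a² ≥ B` fills the whole line. Where `|x_k| ≤ 1` and `x_a² ≥
B`, the factor is at least 1, so `|x_a|` does not shrink. Each shear thus truncates the omitted
prism by `|x_k| ≤ 1` (`image_replaceCoord_truncPoly`). The start is the complement of a solid
parabolic cylinder, obtained from complex squaring.

For the ball, `g(t) t - 1` has a simple zero at 1, a double zero at `n`, and is nonnegative for `t ≥
1`. Hence radii above 1 stay at least 1, and radii `≥ n`, which lie outside the cube since `n > √n`,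
already cover `[1, ∞)`. -/

/-- Post-composing with a polynomial map preserves polynomial maps. -/
theorem IsPolynomialMap.comp {l m n : ℕ}
    {g : EuclideanSpace ℝ (Fin m) → EuclideanSpace ℝ (Fin n)}
    {f : EuclideanSpace ℝ (Fin l) → EuclideanSpace ℝ (Fin m)}
    (hg : IsPolynomialMap g) (hf : IsPolynomialMap f) : IsPolynomialMap (g ∘ f) := by
  obtain ⟨p, hp⟩ := hg
  obtain ⟨q, hq⟩ := hf
  refine ⟨fun i => MvPolynomial.bind₁ q (p i), fun x i => ?_⟩
  have h : (fun j => f x j) = fun j => MvPolynomial.eval (fun j => x j) (q j) :=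
    funext fun j => hq x j
  rw [Function.comp_apply, hp, h]
  simp only [MvPolynomial.eval, MvPolynomial.eval₂Hom_bind₁]

/-- The image of a polynomial image under a polynomial map is a polynomial image. -/
theorem IsPolynomialImage.image {l m n : ℕ} {S : Set (EuclideanSpace ℝ (Fin m))}
    (hS : IsPolynomialImage l S) {g : EuclideanSpace ℝ (Fin m) → EuclideanSpace ℝ (Fin n)}
    (hg : IsPolynomialMap g) : IsPolynomialImage l (g '' S) := by
  obtain ⟨f, hf, rfl⟩ := hS
  exact ⟨g ∘ f, hg.comp hf, Set.range_comp g f⟩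

/-! ### Odd cubics in one variable -/

/-- A continuous real function tending to `+∞` attains on `[a, ∞)` every value `≥ φ a`. -/
theorem exists_ge_eq_of_tendsto_atTop {φ : ℝ → ℝ} (hφ : Continuous φ)
    (hlim : Filter.Tendsto φ Filter.atTop Filter.atTop) {a t : ℝ} (ht : φ a ≤ t) :
    ∃ s, a ≤ s ∧ φ s = t := by
  obtain ⟨b, hab, hb⟩ := ((Filter.eventually_ge_atTop a).and (hlim.eventually_ge_atTop t)).exists
  obtain ⟨s, hs, rfl⟩ := intermediate_value_Icc hab hφ.continuousOn ⟨ht, hb⟩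
  exact ⟨s, hs.1, rfl⟩

theorem tendsto_cubic_atTop {e : ℝ} (he : 0 < e) (b : ℝ) :
    Filter.Tendsto (fun s : ℝ => s * (b + e * s ^ 2)) Filter.atTop Filter.atTop := by
  refine Filter.tendsto_id.atTop_mul_atTop₀ (Filter.tendsto_atTop_add_const_left _ _ ?_)
  exact (Filter.tendsto_pow_atTop two_ne_zero).const_mul_atTop he

/-- For `e < 0`, the odd cubic `s (1 + e (s² - B))` takes each nonpositive value on `[√B, ∞)`. -/
theorem exists_sqrt_le_cubic_eq {e B t : ℝ} (he : e < 0) (ht : t ≤ 0) :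
    ∃ s, √B ≤ s ∧ s * (1 + e * (s ^ 2 - B)) = t := by
  have hlim := tendsto_cubic_atTop (neg_pos.2 he) (e * B - 1)
  have hstart : √B * (e * B - 1 + -e * √B ^ 2) ≤ -t := by
    -- For `B ≤ 0`, `√B` is 0 and the starting value is 0.
    rcases le_total 0 B with hB | hB
    · rw [Real.sq_sqrt hB]
      nlinarith [Real.sqrt_nonneg B]
    · rw [Real.sqrt_eq_zero_of_nonpos hB]
      linarith
  obtain ⟨s, hs, hst⟩ := exists_ge_eq_of_tendsto_atTop (by fun_prop) hlim hstart
  exact ⟨s, hs, by linarith⟩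

/-- For `e < 0`, the odd cubic `s (1 + e (s² - B))` takes every real value on `{s² ≥ B}`. -/
theorem exists_le_sq_cubic_eq {e : ℝ} (B t : ℝ) (he : e < 0) :
    ∃ s, B ≤ s ^ 2 ∧ s * (1 + e * (s ^ 2 - B)) = t := by
  rcases le_total t 0 with ht | ht
  · obtain ⟨s, hs, hst⟩ := exists_sqrt_le_cubic_eq (B := B) he ht
    exact ⟨s, (Real.sqrt_le_iff.1 hs).2, hst⟩
  · obtain ⟨s, hs, hst⟩ := exists_sqrt_le_cubic_eq (B := B) he (neg_nonpos.2 ht)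
    exact ⟨-s, by rw [neg_sq]; exact (Real.sqrt_le_iff.1 hs).2, by rw [neg_sq]; linarith⟩

theorem exists_one_lt_abs_cubic_eq_of_neg {e : ℝ} (t : ℝ) (he : e < 0) :
    ∃ s, 1 < |s| ∧ s * (1 + e * (s ^ 2 - 1)) = t := by
  have key : ∀ t ≤ 0, ∃ s, 1 < s ∧ s * (1 + e * (s ^ 2 - 1)) = t := by
    intro t ht
    obtain ⟨s, hs, hst⟩ := exists_sqrt_le_cubic_eq (B := 1) he ht
    rw [Real.sqrt_one] at hs
    refine ⟨s, lt_of_le_of_ne hs ?_, hst⟩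
    -- At `s = 1` the cubic equals 1, which is not `≤ 0`.
    rintro rfl
    linarith
  rcases le_total t 0 with ht | ht
  · obtain ⟨s, hs, hst⟩ := key t ht
    exact ⟨s, lt_of_lt_of_le hs (le_abs_self s), hst⟩
  · obtain ⟨s, hs, hst⟩ := key (-t) (neg_nonpos.2 ht)
    exact ⟨-s, by rw [abs_neg]; exact lt_of_lt_of_le hs (le_abs_self s), by rw [neg_sq]; linarith⟩

/-- For `e ≥ 0`, the odd cubic `s (1 + e (s² - 1))` takes on `(1, ∞)` every value `> 1`. -/
theorem exists_one_lt_cubic_eq_of_nonneg {e t : ℝ} (he : 0 ≤ e) (ht : 1 < t) :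
    ∃ s, 1 < s ∧ s * (1 + e * (s ^ 2 - 1)) = t := by
  have hmem : t ∈ Set.Icc (1 * (1 + e * (1 ^ 2 - 1))) (t * (1 + e * (t ^ 2 - 1))) := by
    have : 0 ≤ e * (t ^ 2 - 1) := mul_nonneg he (by nlinarith)
    exact ⟨by linarith, by nlinarith⟩
  obtain ⟨s, hs, hst⟩ := intermediate_value_Icc ht.le
    (f := fun s : ℝ => s * (1 + e * (s ^ 2 - 1))) (by fun_prop) hmem
  refine ⟨s, lt_of_le_of_ne hs.1 ?_, hst⟩
  rintro rfl
  simp at hst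
  linarith

theorem exists_one_lt_abs_cubic_eq_of_nonneg {e t : ℝ} (he : 0 ≤ e) (ht : 1 < |t|) :
    ∃ s, 1 < |s| ∧ s * (1 + e * (s ^ 2 - 1)) = t := by
  rcases lt_abs.1 ht with h | h
  · obtain ⟨s, hs, hst⟩ := exists_one_lt_cubic_eq_of_nonneg he h
    exact ⟨s, lt_of_lt_of_le hs (le_abs_self s), hst⟩
  · obtain ⟨s, hs, hst⟩ := exists_one_lt_cubic_eq_of_nonneg he h
    exact ⟨-s, by rw [abs_neg]; exact lt_of_lt_of_le hs (le_abs_self s), by rw [neg_sq]; linarith⟩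

theorem exists_cubic_eq_of_nonneg {e : ℝ} (t : ℝ) (he : 0 ≤ e) :
    ∃ s, s * (1 + e * (s ^ 2 - 1)) = t := by
  rcases he.eq_or_lt with rfl | he
  · exact ⟨t, by ring⟩
  have key : ∀ t, 0 ≤ t → ∃ s, s * (1 + e * (s ^ 2 - 1)) = t := by
    intro t ht
    obtain ⟨s, -, hs⟩ := exists_ge_eq_of_tendsto_atTop (a := 0) (t := t) (by fun_prop)
      (tendsto_cubic_atTop he (1 - e)) (by simpa using ht)
    exact ⟨s, by linarith⟩
  rcases le_total 0 t with ht | ht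
  · exact key t ht
  · obtain ⟨s, hs⟩ := key (-t) (neg_nonneg.2 ht)
    exact ⟨-s, by rw [neg_sq]; linarith⟩

/-! ### The complement of the cube -/

section CoordinateMaps

variable {n : ℕ}

/-- Replace the coordinate `x a` by the value of the polynomial `q` at `x`. -/
noncomputable def replaceCoord (a : Fin n) (q : MvPolynomial (Fin n) ℝ)
    (x : EuclideanSpace ℝ (Fin n)) : EuclideanSpace ℝ (Fin n) :=
  WithLp.toLp 2 (Function.update (fun j => x j) a (MvPolynomial.eval (fun j => x j) q))

theorem replaceCoord_self (a : Fin n) (q : MvPolynomial (Fin n) ℝ)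
    (x : EuclideanSpace ℝ (Fin n)) :
    replaceCoord a q x a = MvPolynomial.eval (fun j => x j) q := by
  simp [replaceCoord]

theorem replaceCoord_of_ne {a i : Fin n} (h : i ≠ a) (q : MvPolynomial (Fin n) ℝ)
    (x : EuclideanSpace ℝ (Fin n)) : replaceCoord a q x i = x i := by
  simp [replaceCoord, h]

theorem isPolynomialMap_replaceCoord (a : Fin n) (q : MvPolynomial (Fin n) ℝ) :
    IsPolynomialMap (replaceCoord a q) := by
  refine ⟨Function.update MvPolynomial.X a q, fun x i => ?_⟩
  rcases eq_or_ne i a with rfl | h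
  · simp [replaceCoord_self]
  · simp [replaceCoord_of_ne h, h]

/-- The vector `x` with its coordinate `a` set to `s`. -/
noncomputable def setCoord (a : Fin n) (s : ℝ) (x : EuclideanSpace ℝ (Fin n)) :
    EuclideanSpace ℝ (Fin n) :=
  WithLp.toLp 2 (Function.update (fun j => x j) a s)

@[simp]
theorem setCoord_self (a : Fin n) (s : ℝ) (x : EuclideanSpace ℝ (Fin n)) :
    setCoord a s x a = s := by
  simp [setCoord]

theorem setCoord_of_ne {a i : Fin n} (h : i ≠ a) (s : ℝ) (x : EuclideanSpace ℝ (Fin n)) :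
    setCoord a s x i = x i := by
  simp [setCoord, h]

/-- Only one coordinate moves, so finding a preimage amounts to solving one equation in one
variable. -/
theorem replaceCoord_setCoord {a : Fin n} {q : MvPolynomial (Fin n) ℝ} {s : ℝ}
    {y : EuclideanSpace ℝ (Fin n)}
    (h : MvPolynomial.eval (fun j => setCoord a s y j) q = y a) :
    replaceCoord a q (setCoord a s y) = y := by
  ext i
  rcases eq_or_ne i a with rfl | hi
  · rw [replaceCoord_self, h]
  · rw [replaceCoord_of_ne hi, setCoord_of_ne hi]

/-- The points some coordinate of which, with index in `S`, lies outside `[-1, 1]`. -/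
def prismCompl (S : Finset (Fin n)) : Set (EuclideanSpace ℝ (Fin n)) :=
  {x | ∃ i ∈ S, 1 < |x i|}

/-- The polynomial `x_a (1 + (1 - x_k²) (x_a² - 1))`. -/
noncomputable def truncPoly (a k : Fin n) : MvPolynomial (Fin n) ℝ :=
  MvPolynomial.X a * (1 + (1 - MvPolynomial.X k ^ 2) * (MvPolynomial.X a ^ 2 - 1))

/-- Truncation of a prism `{|x_i| ≤ 1, i ∈ S}` by the condition `|x_k| ≤ 1`. -/
theorem image_replaceCoord_truncPoly {S : Finset (Fin n)} {a k : Fin n} (ha : a ∈ S) (hk : k ∉ S)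
    {D : Set (EuclideanSpace ℝ (Fin n))} (hSD : prismCompl S ⊆ D)
    (hDS : D ⊆ prismCompl (insert k S)) :
    replaceCoord a (truncPoly a k) '' D = prismCompl (insert k S) := by
  have hka : k ≠ a := fun h => hk (h ▸ ha)
  apply Set.Subset.antisymm
  · rintro _ ⟨x, hx, rfl⟩
    obtain ⟨i, hi, hxi⟩ := hDS hx
    by_cases hxk : 1 < |x k|
    · exact ⟨k, Finset.mem_insert_self k S, by rwa [replaceCoord_of_ne hka]⟩
    refine ⟨i, hi, ?_⟩
    rcases eq_or_ne i a with rfl | hia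
    · rw [replaceCoord_self]
      have h1 : x k ^ 2 ≤ 1 := (sq_le_one_iff_abs_le_one _).2 (not_lt.1 hxk)
      have h2 : 1 < x i ^ 2 := (one_lt_sq_iff_one_lt_abs _).2 hxi
      have h3 : 1 ≤ 1 + (1 - x k ^ 2) * (x i ^ 2 - 1) := by nlinarith
      simp only [truncPoly, map_mul, map_add, map_sub, map_one, map_pow, MvPolynomial.eval_X]
      rw [abs_mul, abs_of_pos (by linarith : 0 < 1 + (1 - x k ^ 2) * (x i ^ 2 - 1))]
      nlinarith
    · rwa [replaceCoord_of_ne hia]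
  · rintro y ⟨i, hi, hyi⟩
    have hval : ∀ s, s * (1 + (1 - y k ^ 2) * (s ^ 2 - 1)) = y a →
        replaceCoord a (truncPoly a k) (setCoord a s y) = y := by
      intro s hs
      apply replaceCoord_setCoord
      simp only [truncPoly, map_mul, map_add, map_sub, map_one, map_pow, MvPolynomial.eval_X,
        setCoord_self, setCoord_of_ne hka, hs]
    have hout : ∀ s, 1 < |s| → s * (1 + (1 - y k ^ 2) * (s ^ 2 - 1)) = y a →
        y ∈ replaceCoord a (truncPoly a k) '' D := fun s hs hsy =>
      ⟨setCoord a s y, hSD ⟨a, ha, by rwa [setCoord_self]⟩, hval s hsy⟩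
    by_cases hyk : 1 < |y k|
    · have := (one_lt_sq_iff_one_lt_abs _).2 hyk
      obtain ⟨s, hs, hsy⟩ := exists_one_lt_abs_cubic_eq_of_neg (e := 1 - y k ^ 2) (y a)
        (by linarith)
      exact hout s hs hsy
    have he : 0 ≤ 1 - y k ^ 2 := by
      have := (sq_le_one_iff_abs_le_one _).2 (not_lt.1 hyk)
      linarith
    by_cases hya : 1 < |y a|
    · obtain ⟨s, hs, hsy⟩ := exists_one_lt_abs_cubic_eq_of_nonneg he hya
      exact hout s hs hsy
    -- Another coordinate in `S` already exceeds 1 in absolute value, so any real root will do.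
    obtain ⟨s, hsy⟩ := exists_cubic_eq_of_nonneg (y a) he
    have hiS : i ∈ S := (Finset.mem_insert.1 hi).resolve_left (fun h => hyk (h ▸ hyi))
    have hia : i ≠ a := fun h => hya (h ▸ hyi)
    exact ⟨setCoord a s y, hSD ⟨i, hiS, by rwa [setCoord_of_ne hia]⟩, hval s hsy⟩

/-- The complement of a solid parabolic cylinder is a polynomial image. -/
theorem isPolynomialImage_parabola_compl {a b : Fin n} (hab : a ≠ b) :
    IsPolynomialImage n {x : EuclideanSpace ℝ (Fin n) | 4 * (x b + 2) ≤ x a ^ 2} := by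
  -- With `w = 1 + x_b² ≥ 1`, this is `(x_a + i w)² - 1`: the imaginary part goes to coordinate `a`,
  -- the real part to `b`.
  refine ⟨fun x => setCoord a (2 * x a * (1 + x b ^ 2))
    (setCoord b (x a ^ 2 - (1 + x b ^ 2) ^ 2 - 1) x), ⟨Function.update (Function.update
      MvPolynomial.X b (MvPolynomial.X a ^ 2 - (1 + MvPolynomial.X b ^ 2) ^ 2 - 1))
      a (2 * MvPolynomial.X a * (1 + MvPolynomial.X b ^ 2)), fun x i => ?_⟩, ?_⟩
  · rcases eq_or_ne i a with rfl | hia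
    · simp
    rcases eq_or_ne i b with rfl | hib
    · simp [setCoord_of_ne hia, hia]
    · simp [setCoord_of_ne hia, setCoord_of_ne hib, hia, hib]
  · apply Set.Subset.antisymm
    · rintro _ ⟨x, rfl⟩
      simp only [Set.mem_ofPred_eq, setCoord_self, setCoord_of_ne hab.symm]
      nlinarith [mul_nonneg (sq_nonneg (x a)) (sq_nonneg (x b)), sq_nonneg (x b),
        mul_nonneg (sq_nonneg (x a)) (sq_nonneg (x b ^ 2)), sq_nonneg (x b ^ 2)]
    · intro y hy
      -- Eliminating `x_a` leaves this quadratic in `W = w²`; `W = 1` gives the bounding parabola.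
      obtain ⟨W, hW, hWy⟩ : ∃ W, 1 ≤ W ∧ W * (y b + 1 + W) = y a ^ 2 / 4 := by
        refine exists_ge_eq_of_tendsto_atTop (φ := fun W => W * (y b + 1 + W)) (by fun_prop)
          (Filter.tendsto_id.atTop_mul_atTop₀
            (Filter.tendsto_atTop_add_const_left _ _ Filter.tendsto_id)) ?_
        have : 4 * (y b + 2) ≤ y a ^ 2 := hy
        linarith
      have hw : 1 ≤ √W := Real.one_le_sqrt.2 hW
      have hw2 : √W ^ 2 = W := Real.sq_sqrt (by linarith)
      have hv : √(√W - 1) ^ 2 = √W - 1 := Real.sq_sqrt (by linarith)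
      refine ⟨setCoord a (y a / (2 * √W)) (setCoord b (√(√W - 1)) y), ?_⟩
      ext i
      rcases eq_or_ne i a with rfl | hia
      · simp only [setCoord_self, setCoord_of_ne hab.symm, hv]
        field_simp
        ring
      rcases eq_or_ne i b with rfl | hib
      · simp only [setCoord_self, setCoord_of_ne hia, hv, add_sub_cancel, div_pow, mul_pow, hw2]
        field_simp
        linarith
      · simp [setCoord_of_ne hia, setCoord_of_ne hib]

/-- The polynomial `x_a (1 + (1 - x_b²) (x_a² - 4 (x_b + 2)))`. -/
noncomputable def parabolaTruncPoly (a b : Fin n) : MvPolynomial (Fin n) ℝ :=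
  MvPolynomial.X a * (1 + (1 - MvPolynomial.X b ^ 2) *
    (MvPolynomial.X a ^ 2 - 4 * (MvPolynomial.X b + 2)))

theorem eval_parabolaTruncPoly (a b : Fin n) (x : Fin n → ℝ) :
    MvPolynomial.eval x (parabolaTruncPoly a b)
      = x a * (1 + (1 - x b ^ 2) * (x a ^ 2 - 4 * (x b + 2))) := by
  simp [parabolaTruncPoly]

/-- The shift by 2 in the parabola forces `x_a² ≥ 4` when `|x_b| ≤ 1`. Bounds on `D` suffice,
because the next truncation has the same image for every such `D`. -/
theorem exists_isPolynomialImage_between {a b : Fin n} (hab : a ≠ b) :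
    ∃ D : Set (EuclideanSpace ℝ (Fin n)), IsPolynomialImage n D ∧
      prismCompl {b} ⊆ D ∧ D ⊆ prismCompl {a, b} := by
  refine ⟨_, (isPolynomialImage_parabola_compl hab).image
    (isPolynomialMap_replaceCoord a (parabolaTruncPoly a b)), ?_, ?_⟩
  · rintro y ⟨i, hi, hyi⟩
    obtain rfl := Finset.mem_singleton.1 hi
    have := (one_lt_sq_iff_one_lt_abs _).2 hyi
    obtain ⟨s, hs, hsy⟩ := exists_le_sq_cubic_eq (e := 1 - y i ^ 2) (4 * (y i + 2)) (y a)
      (by linarith)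
    refine ⟨setCoord a s y, ?_, replaceCoord_setCoord ?_⟩
    · simpa [setCoord_of_ne hab.symm] using hs
    · simpa [eval_parabolaTruncPoly, setCoord_of_ne hab.symm] using hsy
  · rintro _ ⟨x, hx, rfl⟩
    have hx' : 4 * (x b + 2) ≤ x a ^ 2 := hx
    by_cases hxb : 1 < |x b|
    · exact ⟨b, by simp, by rwa [replaceCoord_of_ne hab.symm]⟩
    refine ⟨a, by simp, ?_⟩
    rw [replaceCoord_self, eval_parabolaTruncPoly]
    have h1 : x b ^ 2 ≤ 1 := (sq_le_one_iff_abs_le_one _).2 (not_lt.1 hxb)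
    have h2 : 1 < |x a| := by
      rw [← one_lt_sq_iff_one_lt_abs]
      linarith [(abs_le.1 (not_lt.1 hxb)).1]
    have h3 : 0 ≤ (1 - x b ^ 2) * (x a ^ 2 - 4 * (x b + 2)) :=
      mul_nonneg (by linarith) (by linarith)
    rw [abs_mul, abs_of_pos (by linarith : 0 < 1 + (1 - x b ^ 2) * (x a ^ 2 - 4 * (x b + 2)))]
    nlinarith

theorem isPolynomialImage_prismCompl_union {a b : Fin n} (hab : a ≠ b) (S : Finset (Fin n)) :
    IsPolynomialImage n (prismCompl ({a, b} ∪ S)) := by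
  induction S using Finset.induction_on with
  | empty =>
    obtain ⟨D, hD, h1, h2⟩ := exists_isPolynomialImage_between hab
    -- The roles swap: `x_b` is moved, truncating by `|x_a| ≤ 1`.
    rw [Finset.union_empty, ← image_replaceCoord_truncPoly (Finset.mem_singleton_self b)
      (by simpa using hab) h1 h2]
    exact hD.image (isPolynomialMap_replaceCoord _ _)
  | insert k S _ ih =>
    rw [Finset.union_insert]
    by_cases hk : k ∈ {a, b} ∪ S
    · rwa [Finset.insert_eq_self.2 hk]
    have h : prismCompl ({a, b} ∪ S) ⊆ prismCompl (insert k ({a, b} ∪ S)) :=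
      fun x ⟨i, hi, hx⟩ => ⟨i, Finset.mem_insert_of_mem hi, hx⟩
    rw [← image_replaceCoord_truncPoly (a := a) (by simp) hk subset_rfl h]
    exact ih.image (isPolynomialMap_replaceCoord _ _)

/-- The complement of the cube `[-1,1]ⁿ` is a polynomial image of `ℝⁿ`. -/
theorem isPolynomialImage_compl_closedCube (hn : 2 ≤ n) :
    IsPolynomialImage n (closedCube n)ᶜ := by
  have h := isPolynomialImage_prismCompl_union
    (a := (⟨0, by omega⟩ : Fin n)) (b := ⟨1, by omega⟩) (by simp) Finset.univ
  convert h using 1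
  ext x
  simp [closedCube, prismCompl, ← abs_le]

end CoordinateMaps

/-! ### The radial map -/

section RadialMap

theorem radialQuartic_eval (n : ℕ) (t : ℝ) :
    (radialQuartic n).eval t = (1 + 2 * (n : ℝ)) / (2 * (n : ℝ) ^ 3 * (1 + n) ^ 2) * t ^ 4
      + -((1 + 2 * (n : ℝ) + 3 * (n : ℝ) ^ 2 + 4 * (n : ℝ) ^ 3)
        / (2 * (n : ℝ) ^ 3 * (1 + n) ^ 2)) * t ^ 2
      + (3 + 6 * (n : ℝ) + 4 * (n : ℝ) ^ 2 + 2 * (n : ℝ) ^ 3) / (2 * (n : ℝ) * (1 + n) ^ 2) := by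
  simp [radialQuartic]

theorem isPolynomialMap_radialMap (n : ℕ) : IsPolynomialMap (radialMap n) := by
  let N : MvPolynomial (Fin n) ℝ := ∑ i, MvPolynomial.X i ^ 2
  refine ⟨fun i => (MvPolynomial.C ((1 + 2 * (n : ℝ)) / (2 * (n : ℝ) ^ 3 * (1 + n) ^ 2)) * N ^ 2
    + MvPolynomial.C (-((1 + 2 * (n : ℝ) + 3 * (n : ℝ) ^ 2 + 4 * (n : ℝ) ^ 3)
        / (2 * (n : ℝ) ^ 3 * (1 + n) ^ 2))) * N
    + MvPolynomial.C ((3 + 6 * (n : ℝ) + 4 * (n : ℝ) ^ 2 + 2 * (n : ℝ) ^ 3)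
        / (2 * (n : ℝ) * (1 + n) ^ 2))) * MvPolynomial.X i, fun x i => ?_⟩
  have hN : MvPolynomial.eval (fun j => x j) N = ‖x‖ ^ 2 := by
    simp [N, EuclideanSpace.real_norm_sq_eq]
  simp only [map_mul, map_add, map_pow, MvPolynomial.eval_C, MvPolynomial.eval_X, hN, radialMap,
    PiLp.smul_apply, smul_eq_mul, radialQuartic_eval]
  ring

/-- The coefficients of `g` are chosen for this factorization; its last factor is positive for `t ≥
0`. -/
theorem radialQuartic_eval_mul_sub_one {n : ℕ} (hn : n ≠ 0) (t : ℝ) :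
    (radialQuartic n).eval t * t - 1 = (t - 1) * (t - n) ^ 2 *
      ((1 + 2 * n) / (2 * (n : ℝ) ^ 3 * (1 + n) ^ 2) * (t ^ 2 + (1 + 2 * n) * t) + 1 / n ^ 2) := by
  have h1 : (n : ℝ) ≠ 0 := Nat.cast_ne_zero.2 hn
  have h2 : (1 + n : ℝ) ≠ 0 := by positivity
  rw [radialQuartic_eval]
  field_simp
  ring

theorem one_le_radialQuartic_eval_mul {n : ℕ} (hn : n ≠ 0) {t : ℝ} (ht : 1 ≤ t) :
    1 ≤ (radialQuartic n).eval t * t := by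
  have h := radialQuartic_eval_mul_sub_one hn t
  have : 0 ≤ (t - 1) * (t - n) ^ 2 *
      ((1 + 2 * n) / (2 * (n : ℝ) ^ 3 * (1 + n) ^ 2) * (t ^ 2 + (1 + 2 * n) * t) + 1 / n ^ 2) :=
    mul_nonneg (mul_nonneg (by linarith) (sq_nonneg _)) (by positivity)
  linarith

theorem exists_radialQuartic_eval_mul_eq {n : ℕ} (hn : n ≠ 0) {s : ℝ} (hs : 1 ≤ s) :
    ∃ t, (n : ℝ) ≤ t ∧ (radialQuartic n).eval t * t = s := by
  have h1 : (1 : ℝ) ≤ n := by exact_mod_cast Nat.one_le_iff_ne_zero.2 hn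
  refine exists_ge_eq_of_tendsto_atTop (φ := fun t => (radialQuartic n).eval t * t)
    (by fun_prop) ?_ ?_
  -- A linear lower bound, valid for `t ≥ n + 1`, where `(t - n)² ≥ 1`.
  · have hlim : Filter.Tendsto (fun t : ℝ => 1 + (t - (n + 1)) * (1 / (n : ℝ) ^ 2))
        Filter.atTop Filter.atTop :=
      Filter.tendsto_atTop_add_const_left _ _ (Filter.Tendsto.atTop_mul_const (by positivity)
        (Filter.tendsto_atTop_add_const_right _ _ Filter.tendsto_id))
    refine Filter.tendsto_atTop_mono' _ ?_ hlim
    filter_upwards [Filter.eventually_ge_atTop ((n : ℝ) + 1)] with t ht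
    have h := radialQuartic_eval_mul_sub_one hn t
    have h2 : t - (n + 1) ≤ (t - 1) * (t - n) ^ 2 := by nlinarith
    have h3 : 1 / (n : ℝ) ^ 2 ≤ (1 + 2 * n) / (2 * (n : ℝ) ^ 3 * (1 + n) ^ 2) *
        (t ^ 2 + (1 + 2 * n) * t) + 1 / n ^ 2 := by
      have : 0 ≤ t := by linarith
      exact le_add_of_nonneg_left (by positivity)
    have h4 := mul_le_mul h2 h3 (by positivity) (mul_nonneg (by linarith) (sq_nonneg _))
    linarith
  · have h := radialQuartic_eval_mul_sub_one hn n
    simp only [sub_self] at h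
    linarith

theorem one_lt_norm_of_notMem_closedCube {n : ℕ} {x : EuclideanSpace ℝ (Fin n)}
    (hx : x ∉ closedCube n) : 1 < ‖x‖ := by
  simp only [closedCube, Set.mem_ofPred_eq, Set.mem_Icc, ← abs_le, not_forall, not_le] at hx
  obtain ⟨i, hi⟩ := hx
  exact hi.trans_le (PiLp.norm_apply_le x i)

theorem norm_sq_le_of_mem_closedCube {n : ℕ} {x : EuclideanSpace ℝ (Fin n)}
    (hx : x ∈ closedCube n) : ‖x‖ ^ 2 ≤ n := by
  rw [EuclideanSpace.real_norm_sq_eq]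
  calc ∑ i, x i ^ 2 ≤ ∑ _i : Fin n, (1 : ℝ) :=
        Finset.sum_le_sum fun i _ => (sq_le_one_iff_abs_le_one _).2 (abs_le.2 (hx i))
    _ = n := by simp

theorem radialMap_image_compl_closedCube {n : ℕ} (hn : 2 ≤ n) :
    radialMap n '' (closedCube n)ᶜ = {x : EuclideanSpace ℝ (Fin n) | 1 ≤ ‖x‖} := by
  have hn0 : n ≠ 0 := by omega
  apply Set.Subset.antisymm
  · rintro _ ⟨x, hx, rfl⟩
    have h := one_le_radialQuartic_eval_mul hn0 (one_lt_norm_of_notMem_closedCube hx).le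
    simp only [Set.mem_ofPred_eq, radialMap, norm_smul, Real.norm_eq_abs]
    exact h.trans (mul_le_mul_of_nonneg_right (le_abs_self _) (norm_nonneg x))
  · intro y hy
    have hy1 : 1 ≤ ‖y‖ := hy
    obtain ⟨t, hnt, ht⟩ := exists_radialQuartic_eval_mul_eq hn0 hy1
    have hn2 : (2 : ℝ) ≤ n := by exact_mod_cast hn
    have hnorm : ‖(t / ‖y‖) • y‖ = t := by
      rw [norm_smul, Real.norm_eq_abs, abs_of_nonneg (by apply div_nonneg <;> linarith)]
      field_simp
    refine ⟨(t / ‖y‖) • y, fun hmem => ?_, ?_⟩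
    · have := norm_sq_le_of_mem_closedCube hmem
      rw [hnorm] at this
      -- `t² ≥ n² > n`, as `n ≥ 2`.
      nlinarith
    · rw [radialMap, hnorm, smul_smul, ← mul_div_assoc, ht, div_self (by linarith), one_smul]

end RadialMap

/-! ### Arbitrary balls and conclusion -/

theorem isPolynomialMap_add_smul {n : ℕ} (c : EuclideanSpace ℝ (Fin n)) (r : ℝ) :
    IsPolynomialMap fun x : EuclideanSpace ℝ (Fin n) => c + r • x :=
  ⟨fun i => MvPolynomial.C (c i) + MvPolynomial.C r * MvPolynomial.X i, fun x i => by simp⟩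

theorem image_add_smul_one_le_norm {n : ℕ} (c : EuclideanSpace ℝ (Fin n)) {r : ℝ} (hr : 0 < r) :
    (fun x => c + r • x) '' {x : EuclideanSpace ℝ (Fin n) | 1 ≤ ‖x‖} = (Metric.ball c r)ᶜ := by
  ext y
  simp only [Set.mem_image, Set.mem_ofPred_eq, Set.mem_compl_iff, Metric.mem_ball, not_lt,
    dist_eq_norm]
  constructor
  · rintro ⟨x, hx, rfl⟩
    rw [add_sub_cancel_left, norm_smul, Real.norm_eq_abs, abs_of_pos hr]
    nlinarith
  · intro hy
    refine ⟨r⁻¹ • (y - c), ?_, by rw [smul_inv_smul₀ hr.ne']; abel⟩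
    rw [norm_smul, Real.norm_eq_abs, abs_of_pos (inv_pos.2 hr), ← div_eq_inv_mul]
    exact (one_le_div hr).2 hy

theorem mainTheorem3 (n : ℕ) (hn : 2 ≤ n) :
    (∀ (c : EuclideanSpace ℝ (Fin n)) (r : ℝ), 0 < r → IsPolynomialImage n (Metric.ball c r)ᶜ) ∧
    IsPolynomialMap (radialMap n) ∧
    ∃ f : EuclideanSpace ℝ (Fin n) → EuclideanSpace ℝ (Fin n),
      IsPolynomialMap f ∧ Set.range f = (closedCube n)ᶜ ∧
      IsPolynomialMap (radialMap n ∘ f) ∧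
      Set.range (radialMap n ∘ f) = {x : EuclideanSpace ℝ (Fin n) | 1 ≤ ‖x‖} := by
  obtain ⟨f, hf, hrange⟩ := isPolynomialImage_compl_closedCube hn
  have hρ := isPolynomialMap_radialMap n
  have himage : Set.range (radialMap n ∘ f) = {x : EuclideanSpace ℝ (Fin n) | 1 ≤ ‖x‖} := by
    rw [Set.range_comp, hrange, radialMap_image_compl_closedCube hn]
  refine ⟨fun c r hr => ?_, hρ, f, hf, hrange, hρ.comp hf, himage⟩
  rw [← image_add_smul_one_le_norm c hr]
  exact IsPolynomialImage.image ⟨_, hρ.comp hf, himage⟩ (isPolynomialMap_add_smul c r)
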